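/- An instance $I=(S,T,r,p,l)$ of the rectilinear Steiner tree problem with given topology and length restrictions consists of a finite tree $S$, a set $T\subseteq V(S)$ of terminals, all of which are leaves of $S$ (a vertex of degree at most one), a root $r\in T$, positions $p:T\to\mathbb{R}^2$ with $p(r)=(0,0)$, and length bounds $l:T\to\mathbb{R}$. An embedding $\pi:V(S)\to\mathbb{R}^2$ is feasible for $I$ if $\pi(t)=p(t)$ for all $t\in T$ and $$\sum_{\{v,w\}\in E_S[r,t]}\|\pi(v)-\pi(w)\|_1\le l(t)\qquad\text{for all } t\in T,$$ where $E_S[r,t]$ is the edge set of the unique path from $r$ to $t$ in $S$. Its cost is $c(\pi)=\sum_{\{v,w\}\in E(S)}\|\pi(v)-\pi(w)\|_1$. An optimal solution is a feasible embedding of minimum cost. For $k\in\mathbb{N}=\{0,1,2,\dots\}$ and $x\in\mathbb{R}$ let $\rho_k(x)=\operatorname{sgn}(x)\,2^k\lfloor |x|/2^k\rfloor$, that is, $x$ rounded towards $0$ to a multiple of $2^k$. Let $I_k=(S,T,r,p_k,l_k)$ be the instance with $$p_k(t)=\bigl(\rho_k(p_x(t)),\rho_k(p_y(t))\bigr),\qquad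 l_k(t)=2^k\left\lfloor\frac{l(t)-\|p(t)-p_k(t)\|_1}{2^k}\right\rfloor\qquad(t\in T).$$ Let $n=|T|$ be the number of terminals and let $k\in\mathbb{N}$. If $\sigma_k$ is an optimal solution for $I_k$ and $\sigma_{k+1}$ is an optimal solution for $I_{k+1}$, then $$c(\sigma_{k+1})\le c(\sigma_k)+6n\,2^k.$$ -/

import Mathlib

noncomputable section

namespace SteinerEmbedding

/-- The rectilinear distance in the plane. -/
def l1Dist (a b : ℝ × ℝ) : ℝ := |a.1 - b.1| + |a.2 - b.2|

theorem l1Dist_comm (a b : ℝ × ℝ) : l1Dist a b = l1Dist b a := by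
  simp only [l1Dist, abs_sub_comm]

/-- The length of an edge under an embedding `π` of the vertices into the plane. -/
def edgeLength {V : Type*} (π : V → ℝ × ℝ) : Sym2 V → ℝ :=
  Sym2.lift ⟨fun v w => l1Dist (π v) (π w), fun _ _ => l1Dist_comm _ _⟩

/-- An instance `(S, T, r, p, l)`: a tree `S` on the vertex set `V` whose set `T` of terminals
consists of leaves, a root terminal `r` placed at the origin, terminal positions `p` and length
bounds `l`. The vertices outside `T` are the Steiner points. -/
structure Instance (V : Type*) where
  S : SimpleGraph V
  isTree : S.IsTree
  T : Finset V
  r : T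
  /-- A terminal has at most one neighbour (none only in the tree with a single vertex). -/
  leaf : ∀ t ∈ T, ∀ u w : V, S.Adj t u → S.Adj t w → u = w
  p : T → ℝ × ℝ
  p_root : p r = (0, 0)
  l : T → ℝ

namespace Instance

variable {V : Type*}

/-- The unique path in the tree from the root to `v`. -/
def rootPath (I : Instance V) (v : V) : I.S.Walk I.r v :=
  (I.isTree.existsUnique_path I.r v).choose

theorem rootPath_isPath (I : Instance V) (v : V) : (I.rootPath v).IsPath :=
  (I.isTree.existsUnique_path I.r v).choose_spec.1

/-- The length `d_π(v)` of the root-`v` path. -/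
def pathLength (I : Instance V) (π : V → ℝ × ℝ) (v : V) : ℝ :=
  ((I.rootPath v).edges.map (edgeLength π)).sum

open Classical in
/-- The total length `c(π)` of the tree. -/
def cost [Fintype V] (I : Instance V) (π : V → ℝ × ℝ) : ℝ :=
  ∑ e ∈ I.S.edgeFinset, edgeLength π e

/-- Feasible embeddings: terminals at their positions, all length bounds respected. -/
def IsFeasible (I : Instance V) (π : V → ℝ × ℝ) : Prop :=
  (∀ t : I.T, π t = I.p t) ∧ ∀ t : I.T, I.pathLength π t ≤ I.l t

/-- Feasible embeddings of minimum cost. -/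
def IsOptimal [Fintype V] (I : Instance V) (π : V → ℝ × ℝ) : Prop :=
  I.IsFeasible π ∧ ∀ π' : V → ℝ × ℝ, I.IsFeasible π' → I.cost π ≤ I.cost π'

end Instance

/-- The multiple of `2 ^ k` obtained by rounding `x` towards `0`. -/
def roundCoord (k : ℕ) (x : ℝ) : ℝ :=
  (SignType.sign x : ℝ) * (2 ^ k * (⌊|x| / 2 ^ k⌋ : ℝ))

/-- Rounding both coordinates of a point towards the origin to multiples of `2 ^ k`. -/
def roundPoint (k : ℕ) (a : ℝ × ℝ) : ℝ × ℝ := (roundCoord k a.1, roundCoord k a.2)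

/-- The rounded instance `I_k`: terminals are moved towards the root to `2 ^ k`-integral positions,
and the length bound, reduced by the distance moved, is rounded down to a multiple of `2 ^ k`. -/
def Instance.rounded {V : Type*} (I : Instance V) (k : ℕ) : Instance V where
  S := I.S
  isTree := I.isTree
  T := I.T
  r := I.r
  leaf := I.leaf
  p := fun t => roundPoint k (I.p t)
  p_root := by simp [I.p_root, roundPoint, roundCoord]
  l := fun t => 2 ^ k * (⌊(I.l t - l1Dist (I.p t) (roundPoint k (I.p t))) / 2 ^ k⌋ : ℝ)

end SteinerEmbedding

end

noncomputable section

namespace SteinerEmbedding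

/-! An optimal `σ` for the finer instance is turned into a feasible embedding for the coarser one.
Each coordinate is replaced along every root path by a lazy follower (`follow`) that moves only when
forced to stay within `ε = 3/2 * 2 ^ k` of the original. Edges never grow under this, so after
moving the terminals to their new positions only the at most one edge at each terminal can lengthen,
by at most `2 * ε + 2 * 2 ^ k = 5 * 2 ^ k` (`cost_relocate_le`). The length bounds survive by a
dichotomy per coordinate (`PlayState`, `coordLength_follow_add_le`): the new path is either as short
as possible or saves `2 * ε` over the old one. The saving pays for the tighter bounds; if both
coordinates are shortest, feasibility of the coarser instance itself suffices. -/

theorem l1Dist_nonneg (a b : ℝ × ℝ) : 0 ≤ l1Dist a b := by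
  unfold l1Dist; positivity

theorem l1Dist_self (a : ℝ × ℝ) : l1Dist a a = 0 := by simp [l1Dist]

theorem l1Dist_triangle (a b c : ℝ × ℝ) : l1Dist a c ≤ l1Dist a b + l1Dist b c := by
  have h₁ := abs_sub_le a.1 b.1 c.1
  have h₂ := abs_sub_le a.2 b.2 c.2
  simp only [l1Dist]
  linarith

@[simp]
theorem edgeLength_mk {V : Type*} (π : V → ℝ × ℝ) (u v : V) :
    edgeLength π s(u, v) = l1Dist (π u) (π v) := rfl

/-! ### The play operator -/

/-- The point of `[a - ε, a + ε]` nearest to `q`. -/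
def play (ε q a : ℝ) : ℝ := max (a - ε) (min (a + ε) q)

theorem play_cases {ε : ℝ} (hε : 0 ≤ ε) (q a : ℝ) :
    (q ≤ a - ε ∧ play ε q a = a - ε) ∨ (a + ε ≤ q ∧ play ε q a = a + ε) ∨
      (a - ε ≤ q ∧ q ≤ a + ε ∧ play ε q a = q) := by
  unfold play
  rcases le_total q (a - ε) with h | h
  · left
    exact ⟨h, by rw [min_eq_right (by linarith), max_eq_left h]⟩
  · right
    rcases le_total q (a + ε) with h' | h'
    · right
      exact ⟨h, h', by rw [min_eq_right h', max_eq_right h]⟩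
    · left
      exact ⟨h', by rw [min_eq_left h', max_eq_right (by linarith)]⟩

theorem play_zero_zero {ε : ℝ} (hε : 0 ≤ ε) : play ε 0 0 = 0 := by
  simp [play, hε]

theorem abs_play_sub_le {ε : ℝ} (hε : 0 ≤ ε) (q a : ℝ) : |play ε q a - a| ≤ ε := by
  rw [abs_le]
  rcases play_cases hε q a with ⟨_, h⟩ | ⟨_, h⟩ | ⟨_, _, h⟩ <;> rw [h] <;> constructor <;> linarith

/-- When the target moves from `b` to `a`, the interval around it is translated by `a - b`, so a
point of the old interval needs no longer move to reach the new one. -/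
theorem abs_sub_play_le {ε q a b : ℝ} (hε : 0 ≤ ε) (hq : |q - b| ≤ ε) :
    |q - play ε q a| ≤ |b - a| := by
  have h₁ := le_abs_self (b - a)
  have h₂ := neg_abs_le (b - a)
  rw [abs_le] at hq ⊢
  rcases play_cases hε q a with ⟨_, h⟩ | ⟨_, h⟩ | ⟨_, _, h⟩ <;> rw [h] <;> constructor <;> linarith

/-- What is known after a path of length `L` from `0` to `x` has been followed by the play operator
along a path of length `L'` from `0` to `y`: the follower has not moved, or it has moved in the
direction `s` only, or it has saved `2 * ε`. -/
inductive PlayState (ε L L' x y : ℝ) : Prop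
  | unmoved (hy : y = 0) (hL' : L' = 0) (hL : |x| ≤ L) : PlayState ε L L' x y
  | monotone (s : ℝ) (hs : s = 1 ∨ s = -1) (hL' : L' = s * y)
      (hL : L' + 2 * ε - s * (x - y) ≤ L) : PlayState ε L L' x y
  | saved (hL : L' + 2 * ε + |x - y| ≤ L) : PlayState ε L L' x y

/-- The follower turns around only after the original has crossed the whole interval of width `2 *
ε`, which the follower spent at rest; this is the saving, and it is never lost again. -/
theorem PlayState.step {ε L L' x y : ℝ} (hε : 0 ≤ ε) (hxy : |y - x| ≤ ε)
    (h : PlayState ε L L' x y) (a : ℝ) :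
    PlayState ε (L + |x - a|) (L' + |y - play ε y a|) a (play ε y a) := by
  obtain ⟨hl, hr⟩ := abs_le.1 hxy
  have h₁ := le_abs_self (x - a)
  have h₂ := neg_abs_le (x - a)
  rcases h with ⟨rfl, rfl, hL⟩ | ⟨s, hs, hL', hL⟩ | hL
  · have h₃ := le_abs_self x
    have h₄ := neg_abs_le x
    rcases play_cases hε 0 a with ⟨hq, h⟩ | ⟨hq, h⟩ | ⟨hq, hq', h⟩ <;> rw [h]
    · refine .monotone 1 (.inl rfl) ?_ ?_ <;> rw [abs_of_nonpos (by linarith)] <;> linarith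
    · refine .monotone (-1) (.inr rfl) ?_ ?_ <;> rw [abs_of_nonneg (by linarith)] <;> linarith
    · refine .unmoved rfl (by simp) ?_
      rw [abs_le]; constructor <;> linarith
  · rcases play_cases hε y a with ⟨hq, h⟩ | ⟨hq, h⟩ | ⟨hq, hq', h⟩ <;> rw [h]
    · rw [abs_of_nonpos (by linarith : y - (a - ε) ≤ 0)]
      rcases hs with rfl | rfl
      · exact .monotone 1 (.inl rfl) (by linarith) (by linarith)
      · refine .saved ?_
        rw [abs_of_nonneg (by linarith)]; linarith
    · rw [abs_of_nonneg (by linarith : 0 ≤ y - (a + ε))]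
      rcases hs with rfl | rfl
      · refine .saved ?_
        rw [abs_of_nonpos (by linarith)]; linarith
      · exact .monotone (-1) (.inr rfl) (by linarith) (by linarith)
    · rw [sub_self, abs_zero, add_zero]
      rcases hs with rfl | rfl
      · exact .monotone 1 (.inl rfl) (by linarith) (by linarith)
      · exact .monotone (-1) (.inr rfl) (by linarith) (by linarith)
  · refine .saved ?_
    have h₃ := le_abs_self (x - y)
    have h₄ := neg_abs_le (x - y)
    rcases play_cases hε y a with ⟨hq, h⟩ | ⟨hq, h⟩ | ⟨hq, hq', h⟩ <;> rw [h]
    · rw [abs_of_nonpos (by linarith : y - (a - ε) ≤ 0), abs_of_nonneg (by linarith)]; linarith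
    · rw [abs_of_nonneg (by linarith : 0 ≤ y - (a + ε)), abs_of_nonpos (by linarith)]; linarith
    · have := abs_sub_le a x y
      rw [abs_sub_comm a x] at this
      simp only [sub_self, abs_zero]
      linarith

theorem PlayState.finish {ε L L' x y : ℝ} (h : PlayState ε L L' x y) (z : ℝ) :
    L' + |y - z| ≤ |z| ∨ L' + |y - z| + 2 * ε ≤ L + |x - z| := by
  have h₁ := le_abs_self (x - z)
  have h₂ := neg_abs_le (x - z)
  rcases h with ⟨rfl, rfl, _⟩ | ⟨s, hs, hL', hL⟩ | hL
  · left; simp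
  · have h₃ := le_abs_self z
    have h₄ := neg_abs_le z
    rcases hs with rfl | rfl <;> rcases le_total y z with hz | hz
    -- With `z` ahead, the motion stays monotone from `0`, hence is shortest; with `z` behind, going
    -- back to `z` is the reversal that brings the saving.
    · left; rw [abs_of_nonpos (by linarith)]; linarith
    · right; rw [abs_of_nonneg (by linarith)]; linarith
    · right; rw [abs_of_nonpos (by linarith)]; linarith
    · left; rw [abs_of_nonneg (by linarith)]; linarith
  · right
    have := abs_sub_le y x z
    rw [abs_sub_comm y x] at this
    linarith

/-! ### Root paths -/

namespace Instance

variable {V : Type*} (I : Instance V)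

/-- The last edge of the root path of `v` comes from `u`. -/
def IsParent (u v : V) : Prop :=
  ∃ h : I.S.Adj u v, I.rootPath v = (I.rootPath u).concat h

theorem eq_rootPath {v : V} {p : I.S.Walk I.r v} (hp : p.IsPath) : p = I.rootPath v :=
  (I.isTree.existsUnique_path I.r v).unique hp (I.rootPath_isPath v)

theorem rootPath_root : I.rootPath I.r = .nil :=
  (I.eq_rootPath SimpleGraph.Walk.IsPath.nil).symm

theorem isParent_or_isParent {u v : V} (h : I.S.Adj u v) : I.IsParent u v ∨ I.IsParent v u := by
  by_cases hv : v ∈ (I.rootPath u).support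
  · exact .inr ⟨h.symm, I.isTree.isAcyclic.path_concat (I.rootPath_isPath v) (I.rootPath_isPath u)
      h.symm hv⟩
  · exact .inl ⟨h, (I.eq_rootPath ((I.rootPath_isPath u).concat hv h)).symm⟩

theorem eq_root_or_exists_isParent (v : V) : v = I.r ∨ ∃ u, I.IsParent u v := by
  by_cases h : (I.rootPath v).Nil
  · exact .inl h.eq.symm
  · have hadj := (I.rootPath v).adj_penultimate h
    refine .inr ⟨_, hadj, ?_⟩
    have hc := SimpleGraph.Walk.concat_dropLast hadj
    have hp : (I.rootPath v).dropLast.IsPath :=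
      ((SimpleGraph.Walk.concat_isPath_iff hadj).1 (hc.symm.subst (I.rootPath_isPath v))).1
    rw [← I.eq_rootPath hp, hc]

variable {I}

theorem IsParent.length_eq {u v : V} (h : I.IsParent u v) :
    (I.rootPath v).length = (I.rootPath u).length + 1 := by
  obtain ⟨_, h⟩ := h
  rw [h, SimpleGraph.Walk.length_concat]

theorem IsParent.pathLength_eq {u v : V} (h : I.IsParent u v) (π : V → ℝ × ℝ) :
    I.pathLength π v = I.pathLength π u + l1Dist (π u) (π v) := by
  obtain ⟨_, h⟩ := h
  simp [pathLength, h, SimpleGraph.Walk.edges_concat]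

theorem IsParent.eq_root_of_mem {u v : V} (h : I.IsParent u v) (hu : u ∈ I.T) : u = I.r := by
  rcases I.eq_root_or_exists_isParent u with hr | ⟨w, hw⟩
  · exact hr
  -- A terminal with both a parent and a child would have two neighbours, at different depths.
  · have : w = v := I.leaf u hu w v hw.choose.symm h.choose
    subst this
    have h₁ := h.length_eq
    have h₂ := hw.length_eq
    omega

theorem rootInduction {P : V → Prop} (root : P I.r) (step : ∀ u v, I.IsParent u v → P u → P v)
    (v : V) : P v := by
  suffices ∀ n v, (I.rootPath v).length = n → P v from this _ v rfl
  intro n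
  induction n with
  | zero =>
    intro v hv
    rcases I.eq_root_or_exists_isParent v with rfl | ⟨u, hu⟩
    · exact root
    · have := hu.length_eq
      omega
  | succ n ih =>
    intro v hv
    rcases I.eq_root_or_exists_isParent v with rfl | ⟨u, hu⟩
    · exact root
    · exact step u v hu (ih u (by have := hu.length_eq; omega))

variable (I)

theorem pathLength_root (π : V → ℝ × ℝ) : I.pathLength π I.r = 0 := by
  simp [pathLength, rootPath_root]

theorem l1Dist_le_pathLength (π : V → ℝ × ℝ) (v : V) :
    l1Dist (π I.r) (π v) ≤ I.pathLength π v := by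
  induction v using I.rootInduction with
  | root => rw [pathLength_root, l1Dist_self]
  | step u v h ih =>
    rw [h.pathLength_eq]
    exact (l1Dist_triangle _ (π u) _).trans (by linarith)

/-- The length of the root-`v` path measured in a single coordinate. -/
def coordLength (f : V → ℝ) (v : V) : ℝ := I.pathLength (fun u => (f u, 0)) v

theorem coordLength_root (f : V → ℝ) : I.coordLength f I.r = 0 := I.pathLength_root _

variable {I} in
theorem IsParent.coordLength_eq {u v : V} (h : I.IsParent u v) (f : V → ℝ) :
    I.coordLength f v = I.coordLength f u + |f u - f v| := by
  simp [coordLength, h.pathLength_eq, l1Dist]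

theorem pathLength_eq_coordLength_add (π : V → ℝ × ℝ) (v : V) :
    I.pathLength π v =
      I.coordLength (fun u => (π u).1) v + I.coordLength (fun u => (π u).2) v := by
  induction v using I.rootInduction with
  | root => simp [pathLength_root, coordLength_root]
  | step u v h ih =>
    rw [h.pathLength_eq, h.coordLength_eq, h.coordLength_eq, ih, l1Dist]
    ring

/-! ### Following a coordinate along the tree -/

/-- The play operator applied along all root paths to the coordinate function `f`. -/
def follow (ε : ℝ) (f : V → ℝ) (v : V) : ℝ :=
  ((I.rootPath v).support.map f).foldl (play ε) 0

variable {ε : ℝ} {f : V → ℝ}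

theorem follow_root (hε : 0 ≤ ε) (hf : f I.r = 0) : I.follow ε f I.r = 0 := by
  simp [follow, rootPath_root, hf, play_zero_zero hε]

variable {I} in
theorem IsParent.follow_eq {u v : V} (h : I.IsParent u v) :
    I.follow ε f v = play ε (I.follow ε f u) (f v) := by
  obtain ⟨_, h⟩ := h
  simp [follow, h, SimpleGraph.Walk.support_concat]

theorem abs_follow_sub_le (hε : 0 ≤ ε) (hf : f I.r = 0) (v : V) :
    |I.follow ε f v - f v| ≤ ε := by
  rcases I.eq_root_or_exists_isParent v with rfl | ⟨u, h⟩
  · simpa [I.follow_root hε hf, hf] using hε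
  · rw [h.follow_eq]
    exact abs_play_sub_le hε _ _

theorem abs_follow_sub_follow_le (hε : 0 ≤ ε) (hf : f I.r = 0) {u v : V} (h : I.S.Adj u v) :
    |I.follow ε f u - I.follow ε f v| ≤ |f u - f v| := by
  rcases I.isParent_or_isParent h with h | h
  · rw [h.follow_eq]
    exact abs_sub_play_le hε (I.abs_follow_sub_le hε hf u)
  · rw [h.follow_eq, abs_sub_comm, abs_sub_comm (f u)]
    exact abs_sub_play_le hε (I.abs_follow_sub_le hε hf v)

theorem playState_follow (hε : 0 ≤ ε) (hf : f I.r = 0) (v : V) :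
    PlayState ε (I.coordLength f v) (I.coordLength (I.follow ε f) v) (f v) (I.follow ε f v) := by
  induction v using I.rootInduction with
  | root =>
    refine .unmoved (I.follow_root hε hf) (I.coordLength_root _) ?_
    rw [hf, coordLength_root, abs_zero]
  | step u v h ih =>
    rw [h.coordLength_eq, h.coordLength_eq, h.follow_eq]
    exact ih.step hε (I.abs_follow_sub_le hε hf u) (f v)

/-- If a path ends at `z` instead of `f v` and follows `f` before, then it is either shortest
possible or shorter than the path of `f`. -/
theorem coordLength_follow_add_le (hε : 0 ≤ ε) (hf : f I.r = 0) {u v : V} (h : I.IsParent u v)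
    (z : ℝ) :
    I.coordLength (I.follow ε f) u + |I.follow ε f u - z| ≤ |z| ∨
      I.coordLength (I.follow ε f) u + |I.follow ε f u - z| + 2 * ε ≤
        I.coordLength f v + |f v - z| := by
  refine ((I.playState_follow hε hf u).finish z).imp_right fun h' => ?_
  rw [h.coordLength_eq]
  linarith [abs_sub_le (f u) (f v) z]

/-! ### Relocating the terminals -/

/-- Both coordinates of `π` are followed, and the terminals are placed at `q`. -/
def relocate (ε : ℝ) (π : V → ℝ × ℝ) (q : I.T → ℝ × ℝ) (v : V) : ℝ × ℝ :=
  open Classical in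
  if h : v ∈ I.T then q ⟨v, h⟩
  else (I.follow ε (fun u => (π u).1) v, I.follow ε (fun u => (π u).2) v)

variable {π : V → ℝ × ℝ} {q : I.T → ℝ × ℝ}

theorem relocate_terminal (t : I.T) : I.relocate ε π q t = q t := by
  simp [relocate]

variable {I} in
theorem IsParent.relocate_eq (hε : 0 ≤ ε) (hπ : π I.r = (0, 0)) (hq : q I.r = (0, 0)) {u v : V}
    (h : I.IsParent u v) : I.relocate ε π q u =
      (I.follow ε (fun u => (π u).1) u, I.follow ε (fun u => (π u).2) u) := by
  by_cases hu : u ∈ I.T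
  · obtain rfl := h.eq_root_of_mem hu
    rw [I.relocate_terminal I.r, hq, I.follow_root hε (by simp [hπ]),
      I.follow_root hε (by simp [hπ])]
  · simp [relocate, hu]

variable {I} in
-- Terminals other than the root have no children, so relocating them leaves the path to any parent
-- untouched.
theorem IsParent.pathLength_relocate (hε : 0 ≤ ε) (hπ : π I.r = (0, 0)) (hq : q I.r = (0, 0))
    {u v : V} (h : I.IsParent u v) : I.pathLength (I.relocate ε π q) u =
      I.coordLength (I.follow ε (fun u => (π u).1)) u +
        I.coordLength (I.follow ε (fun u => (π u).2)) u := by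
  induction u using I.rootInduction generalizing v with
  | root => simp [pathLength_root, coordLength_root]
  | step w u hw ih =>
    rw [hw.pathLength_eq, ih hw, hw.relocate_eq hε hπ hq, h.relocate_eq hε hπ hq,
      hw.coordLength_eq, hw.coordLength_eq, l1Dist]
    ring

theorem l1Dist_relocate_le (hε : 0 ≤ ε) (hπ : π I.r = (0, 0)) {D : ℝ}
    (hD : ∀ t : I.T, l1Dist (π t) (q t) ≤ D) (v : V) :
    l1Dist (I.relocate ε π q v)
        (I.follow ε (fun u => (π u).1) v, I.follow ε (fun u => (π u).2) v) ≤
      open Classical in if v ∈ I.T then 2 * ε + D else 0 := by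
  by_cases hv : v ∈ I.T
  · have h₁ := I.abs_follow_sub_le (f := fun u => (π u).1) hε (by simp [hπ]) v
    have h₂ := I.abs_follow_sub_le (f := fun u => (π u).2) hε (by simp [hπ]) v
    have h₃ := hD ⟨v, hv⟩
    have h₄ := l1Dist_triangle
      (I.follow ε (fun u => (π u).1) v, I.follow ε (fun u => (π u).2) v) (π v) (q ⟨v, hv⟩)
    rw [if_pos hv, I.relocate_terminal ⟨v, hv⟩, l1Dist_comm]
    refine h₄.trans ?_
    have h₅ : l1Dist (I.follow ε (fun u => (π u).1) v, I.follow ε (fun u => (π u).2) v) (π v) ≤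
        2 * ε := by
      simp only [l1Dist]
      linarith
    exact add_le_add h₅ h₃
  · simp [relocate, hv, l1Dist_self]

open Classical in
theorem edgeLength_relocate_le (hε : 0 ≤ ε) (hπ : π I.r = (0, 0)) {D : ℝ}
    (hD : ∀ t : I.T, l1Dist (π t) (q t) ≤ D) {e : Sym2 V} (he : e ∈ I.S.edgeSet) :
    edgeLength (I.relocate ε π q) e ≤
      edgeLength π e + ∑ t ∈ I.T, if t ∈ e then 2 * ε + D else 0 := by
  induction e with | _ u v
  have huv : I.S.Adj u v := he
  have h₁ := I.abs_follow_sub_follow_le (f := fun u => (π u).1) hε (by simp [hπ]) huv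
  have h₂ := I.abs_follow_sub_follow_le (f := fun u => (π u).2) hε (by simp [hπ]) huv
  have h₃ := I.l1Dist_relocate_le hε hπ hD u
  have h₄ := I.l1Dist_relocate_le hε hπ hD v
  rw [l1Dist_comm] at h₄
  set yu := (I.follow ε (fun u => (π u).1) u, I.follow ε (fun u => (π u).2) u) with hyu
  set yv := (I.follow ε (fun u => (π u).1) v, I.follow ε (fun u => (π u).2) v) with hyv
  have h₅ : l1Dist yu yv ≤ l1Dist (π u) (π v) := add_le_add h₁ h₂
  have h₆ := l1Dist_triangle (I.relocate ε π q u) yu (I.relocate ε π q v)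
  have h₇ := l1Dist_triangle yu yv (I.relocate ε π q v)
  have h₈ : (∑ t ∈ I.T, if t ∈ s(u, v) then 2 * ε + D else 0) =
      (if u ∈ I.T then 2 * ε + D else 0) + if v ∈ I.T then 2 * ε + D else 0 := by
    rw [← Finset.sum_ite_eq' I.T u fun _ => 2 * ε + D,
      ← Finset.sum_ite_eq' I.T v fun _ => 2 * ε + D, ← Finset.sum_add_distrib]
    refine Finset.sum_congr rfl fun t _ => ?_
    have := huv.ne
    by_cases h : t = u
    · subst h; simp [this]
    · simp [h]
  rw [edgeLength_mk, edgeLength_mk, h₈]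
  linarith

theorem cost_relocate_le [Fintype V] (hε : 0 ≤ ε) (hπ : π I.r = (0, 0)) {D : ℝ} (hD₀ : 0 ≤ D)
    (hD : ∀ t : I.T, l1Dist (π t) (q t) ≤ D) :
    I.cost (I.relocate ε π q) ≤ I.cost π + I.T.card * (2 * ε + D) := by
  classical
  have h : ∑ e ∈ I.S.edgeFinset, ∑ t ∈ I.T, (if t ∈ e then 2 * ε + D else 0) ≤
      I.T.card * (2 * ε + D) := by
    -- Summing over terminals first, each is charged at most once because it is a leaf.
    rw [Finset.sum_comm, ← nsmul_eq_mul]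
    refine Finset.sum_le_card_nsmul _ _ _ fun t ht => ?_
    rw [← Finset.sum_filter, Finset.sum_const, nsmul_eq_mul]
    refine mul_le_of_le_one_left (by linarith) (Nat.cast_le_one.2 (Finset.card_le_one.2 ?_))
    intro e he e' he'
    rw [Finset.mem_filter, SimpleGraph.mem_edgeFinset] at he he'
    obtain ⟨he, u, rfl⟩ := he
    obtain ⟨he', w, rfl⟩ := he'
    rw [I.leaf t ht u w he he']
  have h' := Finset.sum_le_sum fun e (he : e ∈ I.S.edgeFinset) =>
    I.edgeLength_relocate_le hε hπ hD (SimpleGraph.mem_edgeFinset.1 he)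
  rw [Finset.sum_add_distrib] at h'
  unfold cost
  convert h'.trans (add_le_add_right h _) using 1

end Instance

/-! ### Rounding -/

theorem exists_floor_eq_two_mul_add (a : ℝ) :
    ∃ j : ℤ, (j = 0 ∨ j = 1) ∧ (⌊a⌋ : ℤ) = 2 * ⌊a / 2⌋ + j := by
  refine ⟨⌊a⌋ - 2 * ⌊a / 2⌋, ?_, by ring⟩
  have h₁ : 2 * ⌊a / 2⌋ ≤ ⌊a⌋ := Int.le_floor.2 (by
    push_cast; linarith [Int.floor_le (a / 2)])
  have h₂ : ⌊a⌋ < 2 * ⌊a / 2⌋ + 2 := Int.floor_lt.2 (by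
    push_cast; linarith [Int.lt_floor_add_one (a / 2)])
  omega

/-- Rounding to the next coarser grid moves a rounded coordinate by nothing or by one grid width,
towards zero and further away from the original value. -/
theorem exists_roundCoord_succ (k : ℕ) (a : ℝ) : ∃ j : ℤ, (j = 0 ∨ j = 1) ∧
    |roundCoord k a - roundCoord (k + 1) a| = j * 2 ^ k ∧
    |roundCoord k a| = |roundCoord (k + 1) a| + j * 2 ^ k ∧
    |a - roundCoord (k + 1) a| = |a - roundCoord k a| + j * 2 ^ k := by
  have hd : (0 : ℝ) < 2 ^ k := by positivity
  obtain ⟨j, hj, hfl⟩ := exists_floor_eq_two_mul_add (|a| / 2 ^ k)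
  have hdiv : |a| / 2 ^ (k + 1) = |a| / 2 ^ k / 2 := by rw [pow_succ, div_div]
  have hle : 2 ^ k * (⌊|a| / 2 ^ k⌋ : ℝ) ≤ |a| := by
    have := Int.floor_le (|a| / 2 ^ k)
    rwa [le_div_iff₀ hd, mul_comm] at this
  have hnn : (0 : ℝ) ≤ 2 ^ (k + 1) * ⌊|a| / 2 ^ (k + 1)⌋ := by
    have : 0 ≤ ⌊|a| / 2 ^ (k + 1)⌋ := Int.floor_nonneg.2 (by positivity)
    positivity
  have hjr : (0 : ℝ) ≤ j := by rcases hj with rfl | rfl <;> simp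
  have heq : (2 : ℝ) ^ k * ⌊|a| / 2 ^ k⌋ = 2 ^ (k + 1) * ⌊|a| / 2 ^ (k + 1)⌋ + j * 2 ^ k := by
    rw [hdiv, hfl]; push_cast; ring
  have hjd : (0 : ℝ) ≤ j * 2 ^ k := by positivity
  unfold roundCoord
  generalize (2 : ℝ) ^ k * ⌊|a| / 2 ^ k⌋ = c at *
  generalize (2 : ℝ) ^ (k + 1) * ⌊|a| / 2 ^ (k + 1)⌋ = c' at *
  rcases lt_trichotomy a 0 with ha | rfl | ha
  · refine ⟨j, hj, ?_⟩
    rw [abs_of_neg ha] at hle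
    simp only [sign_neg ha, SignType.coe_neg_one, neg_one_mul, abs_neg]
    rw [abs_of_nonpos (by linarith), abs_of_nonneg (by linarith), abs_of_nonneg hnn,
      abs_of_nonpos (by linarith), abs_of_nonpos (by linarith)]
    refine ⟨?_, ?_, ?_⟩ <;> linarith
  · exact ⟨0, .inl rfl, by simp⟩
  · refine ⟨j, hj, ?_⟩
    rw [abs_of_pos ha] at hle
    simp only [sign_pos ha, SignType.coe_one, one_mul]
    rw [abs_of_nonneg (by linarith), abs_of_nonneg (by linarith), abs_of_nonneg hnn,
      abs_of_nonneg (by linarith), abs_of_nonneg (by linarith)]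
    refine ⟨?_, ?_, ?_⟩ <;> linarith

/-- The extra `2 ^ k` covers the parity bit lost by halving the floor. -/
theorem le_floor_succ (k : ℕ) (a : ℝ) (j : ℤ) :
    2 ^ k * (⌊a / 2 ^ k⌋ : ℝ) - j * 2 ^ k - 2 ^ k ≤
      2 ^ (k + 1) * (⌊(a - j * 2 ^ k) / 2 ^ (k + 1)⌋ : ℝ) := by
  have hd : (0 : ℝ) < 2 ^ k := by positivity
  obtain ⟨i, hi, hfl⟩ := exists_floor_eq_two_mul_add (a / 2 ^ k - j)
  have h : (a - j * 2 ^ k) / 2 ^ (k + 1) = (a / 2 ^ k - j) / 2 := by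
    rw [pow_succ]; field_simp
  rw [Int.floor_sub_intCast] at hfl
  have hfl' : (⌊a / 2 ^ k⌋ : ℝ) - j = 2 * ⌊(a / 2 ^ k - j) / 2⌋ + i := by exact_mod_cast hfl
  have hi' : (i : ℝ) ≤ 1 := by rcases hi with rfl | rfl <;> simp
  rw [h, pow_succ]
  nlinarith

theorem Instance.relocate_isFeasible {V : Type*} (I : Instance V) (k : ℕ) {σ σ' : V → ℝ × ℝ}
    (hσ : (I.rounded k).IsFeasible σ) (hσ' : (I.rounded (k + 1)).IsFeasible σ') :
    (I.rounded (k + 1)).IsFeasible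
      (I.relocate (3 / 2 * 2 ^ k) σ fun t => roundPoint (k + 1) (I.p t)) := by
  have hd : (0 : ℝ) < 2 ^ k := by positivity
  have hε : (0 : ℝ) ≤ 3 / 2 * 2 ^ k := by positivity
  have hroot : σ I.r = (0, 0) := (hσ.1 I.r).trans (I.rounded k).p_root
  have hroot' : σ' I.r = (0, 0) := (hσ'.1 I.r).trans (I.rounded (k + 1)).p_root
  have hq : roundPoint (k + 1) (I.p I.r) = (0, 0) := (I.rounded (k + 1)).p_root
  refine ⟨I.relocate_terminal, fun (t : I.T) => ?_⟩
  -- The only use of `σ'`: the new bound is at least the distance from the root to the new position.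
  have hshort := (I.l1Dist_le_pathLength σ' t).trans (hσ'.2 t)
  rw [show σ' t = roundPoint (k + 1) (I.p t) from hσ'.1 t, hroot'] at hshort
  change I.pathLength _ (t : V) ≤ _
  rcases I.eq_root_or_exists_isParent t with ht | ⟨u, hu⟩
  · rw [ht, pathLength_root]
    exact (l1Dist_nonneg _ _).trans hshort
  have hlen : I.pathLength σ t ≤ 2 ^ k * _ := hσ.2 t
  have hσt : σ t = roundPoint k (I.p t) := hσ.1 t
  obtain ⟨i, hi, hi₁, hi₂, hi₃⟩ := exists_roundCoord_succ k (I.p t).1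
  obtain ⟨j, hj, hj₁, hj₂, hj₃⟩ := exists_roundCoord_succ k (I.p t).2
  have hx := I.coordLength_follow_add_le (f := fun v => (σ v).1) hε (by simp [hroot]) hu
    (roundCoord (k + 1) (I.p t).1)
  have hy := I.coordLength_follow_add_le (f := fun v => (σ v).2) hε (by simp [hroot]) hu
    (roundCoord (k + 1) (I.p t).2)
  have hLx := I.l1Dist_le_pathLength (fun v => ((σ v).1, 0)) t
  have hLy := I.l1Dist_le_pathLength (fun v => ((σ v).2, 0)) t
  change _ ≤ I.coordLength _ _ at hLx
  change _ ≤ I.coordLength _ _ at hLy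
  simp only [l1Dist, hσt, hroot, roundPoint, sub_self, abs_zero, add_zero, zero_sub,
    abs_neg] at hLx hLy
  simp only [hσt, roundPoint, hi₁] at hx
  simp only [hσt, roundPoint, hj₁] at hy
  simp only [l1Dist, roundPoint, zero_sub, abs_neg] at hshort
  rw [pathLength_eq_coordLength_add] at hlen
  rw [hu.pathLength_eq, hu.pathLength_relocate hε hroot hq, hu.relocate_eq hε hroot hq,
    I.relocate_terminal]
  have hdist : l1Dist (I.p t) (roundPoint (k + 1) (I.p t)) =
      l1Dist (I.p t) (roundPoint k (I.p t)) + (i + j : ℤ) * 2 ^ k := by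
    simp only [l1Dist, roundPoint]
    push_cast
    linarith
  have hl : _ ≤ (I.rounded (k + 1)).l t := (le_floor_succ k
    (I.l t - l1Dist (I.p t) (roundPoint k (I.p t))) (i + j)).trans_eq (by
      rw [sub_sub, ← hdist]; rfl)
  push_cast at hl
  have hi' : (i : ℝ) * 2 ^ k ≤ 2 ^ k := by rcases hi with rfl | rfl <;> simp
  have hj' : (j : ℝ) * 2 ^ k ≤ 2 ^ k := by rcases hj with rfl | rfl <;> simp
  simp only [l1Dist, roundPoint] at hlen hl ⊢
  -- The mixed cases fix `ε`: if only `x` saves, the path changes by at most `(i - j - 3) * 2 ^ k`,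
  -- while the bound may drop by `(i + j + 1) * 2 ^ k`; this is tight for `i = 1`.
  rcases hx with hx | hx <;> rcases hy with hy | hy <;> linarith

end SteinerEmbedding

end

theorem mainTheorem4 {V : Type*} [Fintype V] (I : SteinerEmbedding.Instance V) (k : ℕ)
    (σ σ' : V → ℝ × ℝ) (hσ : (I.rounded k).IsOptimal σ)
    (hσ' : (I.rounded (k + 1)).IsOptimal σ') :
    (I.rounded (k + 1)).cost σ' ≤ (I.rounded k).cost σ + 6 * (I.T.card : ℝ) * 2 ^ k := by
  have hd : (0 : ℝ) < 2 ^ k := by positivity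
  refine (hσ'.2 _ (I.relocate_isFeasible k hσ.1 hσ'.1)).trans ?_
  have h := I.cost_relocate_le (ε := 3 / 2 * 2 ^ k) (π := σ) (D := 2 * 2 ^ k)
    (q := fun t => SteinerEmbedding.roundPoint (k + 1) (I.p t)) (by positivity)
    ((hσ.1.1 I.r).trans (I.rounded k).p_root) (by positivity) fun t => ?_
  · have hn : (0 : ℝ) ≤ I.T.card * 2 ^ k := by positivity
    change I.cost _ ≤ I.cost σ + _
    linarith
  · rw [show σ t = SteinerEmbedding.roundPoint k (I.p t) from hσ.1.1 t]
    obtain ⟨i, hi, hi₁, -⟩ := SteinerEmbedding.exists_roundCoord_succ k (I.p t).1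
    obtain ⟨j, hj, hj₁, -⟩ := SteinerEmbedding.exists_roundCoord_succ k (I.p t).2
    simp only [SteinerEmbedding.l1Dist, SteinerEmbedding.roundPoint, hi₁, hj₁]
    have hi' : (i : ℝ) * 2 ^ k ≤ 2 ^ k := by rcases hi with rfl | rfl <;> simp
    have hj' : (j : ℝ) * 2 ^ k ≤ 2 ^ k := by rcases hj with rfl | rfl <;> simp
    linarith
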